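/- Let $|\cdot|$ be a fixed norm on $\mathbb R^d$, let $\mathrm{haus}$ be the associated Hausdorff distance between nonempty compact subsets of $\mathbb R^d$, and let $a<b$. Let $F$ be a function from $[a,b]$ to the nonempty compact subsets of $\mathbb R^d$ which is of bounded variation with respect to $\mathrm{haus}$ and whose graph $\{(x,y): x\in[a,b],\ y\in F(x)\}$ is compact. Put $v_F(x)=V_a^x(F)$ (the variation of $F$ on $[a,x]$), $\|F\|_\infty=\sup_{x\in[a,b]}\mathrm{haus}(F(x),\{0\})$ and, for $\delta>0$, $$\omega(v_F,x,\delta)=\sup\{|v_F(x_1)-v_F(x_2)| : x_1,x_2\in[x-\delta/2,x+\delta/2]\cap[a,b]\}.$$ A metric chain of nonempty compact sets $A_0,\dots,A_m$ is a tuple $(y_0,\dots,y_m)$ with $y_i\in A_i$ such that for each $i<m$ either $|y_i-y_{i+1}|=\mathrm{dist}(y_{i+1},A_i)$ or $|y_i-y_{i+1}|=\mathrm{dist}(y_i,A_{i+1})$. For $\kappa:[a,b]\to\mathbb R$ and a partition $\chi$: $a=x_0<\dots<x_m=b$ with norm $|\chi|=\max_i(x_{i+1}-x_i)$, let $$S_\chi^\kappa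 F=\Big\{\sum_{i=0}^{m-1}(x_{i+1}-x_i)\kappa(x_i)y_i : (y_0,\dots,y_{m-1})\text{ is a metric chain of }F(x_0),\dots,F(x_{m-1})\Big\}.$$ The weighted metric integral of $F$ with weight $\kappa$ is the upper Kuratowski limit $\limsup_{|\chi|\to0}S_\chi^\kappa F$, that is, the set of all limits of convergent sequences $v_k\in S_{\chi_k}^\kappa F$ with $|\chi_k|\to0$. Let $\mathcal K_n:[a,b]\times[a,b]\to\mathbb R$, $n\in\mathbb N$, be such that $\mathcal K_n(x,\cdot)$ is of bounded variation on $[a,b]$ for all $n$ and all $x\in[a,b]$. Let $T_nF(x)$ be the weighted metric integral of $F$ with weight $\mathcal K_n(x,\cdot)$, and put $$\alpha_n(x)=\Big|\int_a^b\mathcal K_n(x,t)\,dt-1\Big|,\qquad \beta_n(x,\delta)=\int_{t\in[a,b],\,|x-t|\ge\delta}|\mathcal K_n(x,t)|\,dt.$$ For $x\in[a,b]$ let $M(x)\in[0,\infty]$ satisfy $\int_a^b|\mathcal K_n(x,t)|\,dt\le M(x)$ for all $n$. Then each $T_nF(x)$ is a nonempty compact set, and the following hold. (i) For all $x\in[a,b]$,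 $\delta>0$ and $n\in\mathbb N$ (with the convention $0\cdot\infty=0$), $$\mathrm{haus}(T_nF(x),F(x))\le\omega(v_F,x,4\delta)\,M(x)+\|F\|_\infty\,(2\beta_n(x,\delta)+\alpha_n(x)).$$ (ii) Let $x\in[a,b]$. If $\lim_n\alpha_n(x)=0$, $\lim_n\beta_n(x,\delta)=0$ for all sufficiently small $\delta>0$, $M(x)<\infty$, and $F$ is continuous at $x$, then $\lim_n\mathrm{haus}(T_nF(x),F(x))=0$. (iii) Let $I\subseteq[a,b]$ be a closed interval. If $F$ (as a function on $[a,b]$) is continuous at every point of $I$, if $\alpha_n(x)\to0$ uniformly in $x\in I$, if for all sufficiently small $\delta>0$ also $\beta_n(x,\delta)\to0$ uniformly in $x\in I$, and if $M$ is bounded on $I$, then $\mathrm{haus}(T_nF(x),F(x))\to0$ uniformly in $x\in I$. -/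

import Mathlib

open Set Filter Topology MeasureTheory TopologicalSpace
open scoped ENNReal

noncomputable section

namespace SVF

/-- A partition `a = x₀ < x₁ < ⋯ < xₙ = b` of `[a, b]`; the values `pts i` for `i > n` play
no role. -/
structure Part (a b : ℝ) where
  n : ℕ
  pts : ℕ → ℝ
  pts_zero : pts 0 = a
  pts_last : pts n = b
  lt_succ : ∀ i < n, pts i < pts (i + 1)

/-- The norm `|χ| = max (xᵢ₊₁ - xᵢ)` of a partition. -/
def Part.mesh {a b : ℝ} (χ : Part a b) : ℝ :=
  ⨆ i : Fin χ.n, (χ.pts (i + 1) - χ.pts i)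

/-- The upper Kuratowski limit of a sequence of sets: all limits of sequences of points taken
from a subsequence of the sets. -/
def upperKuratowskiLimit {E : Type*} [TopologicalSpace E] (A : ℕ → Set E) : Set E :=
  {v | ∃ φ : ℕ → ℕ, StrictMono φ ∧ ∃ y : ℕ → E, (∀ k, y k ∈ A (φ k)) ∧ Tendsto y atTop (𝓝 v)}

/-- `(u, v)` is a metric pair of `(A, B)`: `u ∈ A`, `v ∈ B`, and `u` is a projection of `v` on `A`
or `v` is a projection of `u` on `B`. -/
def IsMetricPair {E : Type*} [PseudoMetricSpace E] (A B : Set E) (u v : E) : Prop :=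
  u ∈ A ∧ v ∈ B ∧ (dist v u = Metric.infDist v A ∨ dist u v = Metric.infDist u B)

/-- `(y 0, …, y (m - 1))` is a metric chain of the `m` sets `A 0, …, A (m - 1)`. (For `m ≥ 2` the
first condition follows from the second.) -/
def IsMetricChain {E : Type*} [PseudoMetricSpace E] (m : ℕ) (A : ℕ → Set E) (y : ℕ → E) : Prop :=
  (∀ i < m, y i ∈ A i) ∧ ∀ i, i + 1 < m → IsMetricPair (A i) (A (i + 1)) (y i) (y (i + 1))

/-- Local modulus of continuity at `x` of a function on `[a, b]`. -/
def localModulus {X : Type*} [PseudoMetricSpace X] (a b : ℝ) (f : ℝ → X) (x δ : ℝ) : ℝ :=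
  sSup {r | ∃ x₁ ∈ Icc (x - δ / 2) (x + δ / 2) ∩ Icc a b,
    ∃ x₂ ∈ Icc (x - δ / 2) (x + δ / 2) ∩ Icc a b, r = dist (f x₁) (f x₂)}

/-- The variation function `v_f(x) = V_a^x(f)` of a function on `[a, b]`. -/
def varFun {X : Type*} [PseudoEMetricSpace X] (a b : ℝ) (f : ℝ → X) (x : ℝ) : ℝ :=
  variationOnFromTo f (Icc a b) a x

section SetValued

variable {E : Type*} [NormedAddCommGroup E] [NormedSpace ℝ E]

/-- The graph of the multifunction `F` on `[a, b]`. -/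
def graphOn (a b : ℝ) (F : ℝ → NonemptyCompacts E) : Set (ℝ × E) :=
  {p | p.1 ∈ Icc a b ∧ p.2 ∈ F p.1}

/-- `F`, as a multifunction on `[a, b]`, is of bounded variation with respect to the Hausdorff
metric and has a compact graph. -/
def IsBVCompactGraph (a b : ℝ) (F : ℝ → NonemptyCompacts E) : Prop :=
  BoundedVariationOn F (Icc a b) ∧ IsCompact (graphOn a b F)

/-- `‖F‖_∞ = sup_{x ∈ [a, b]} |F(x)|`, with `|A|` the Hausdorff distance of `A` to `{0}`. -/
def supNorm (a b : ℝ) (F : ℝ → NonemptyCompacts E) : ℝ :=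
  ⨆ x : Icc a b, Metric.hausdorffDist (F x : Set E) {0}

/-- The weighted metric Riemann sum of `F` with weight `κ` on the partition `χ`: all sums
`∑_{i<n} (xᵢ₊₁ - xᵢ) κ(xᵢ) yᵢ` over metric chains `(y₀, …, yₙ₋₁)` of `F(x₀), …, F(xₙ₋₁)`. -/
def metricRiemannSum {a b : ℝ} (κ : ℝ → ℝ) (F : ℝ → NonemptyCompacts E) (χ : Part a b) : Set E :=
  {v | ∃ y : ℕ → E, IsMetricChain χ.n (fun i => (F (χ.pts i) : Set E)) y ∧
    v = ∑ i ∈ Finset.range χ.n, ((χ.pts (i + 1) - χ.pts i) * κ (χ.pts i)) • y i}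

/-- The weighted metric integral of `F` with weight `κ`: the upper Kuratowski limit of the weighted
metric Riemann sums as the norm of the partition tends to `0`. -/
def weightedMetricIntegral (a b : ℝ) (κ : ℝ → ℝ) (F : ℝ → NonemptyCompacts E) : Set E :=
  {v | ∃ χ : ℕ → Part a b, Tendsto (fun k => (χ k).mesh) atTop (𝓝 0) ∧
    v ∈ upperKuratowskiLimit (fun k => metricRiemannSum κ F (χ k))}

/-- The metric integral operator `T_n F(x)` with kernels `K n x t`. -/
def metricOp (a b : ℝ) (K : ℕ → ℝ → ℝ → ℝ) (F : ℝ → NonemptyCompacts E) (n : ℕ) (x : ℝ) : Set E :=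
  weightedMetricIntegral a b (K n x) F

end SetValued

/-- `α_n(x) = |∫_a^b K_n(x, t) dt - 1|`. -/
def kerAlpha (a b : ℝ) (K : ℕ → ℝ → ℝ → ℝ) (n : ℕ) (x : ℝ) : ℝ :=
  |(∫ t in a..b, K n x t) - 1|

/-- `β_n(x, δ) = ∫_{t ∈ [a, b], |x - t| ≥ δ} |K_n(x, t)| dt`. -/
def kerBeta (a b : ℝ) (K : ℕ → ℝ → ℝ → ℝ) (n : ℕ) (x δ : ℝ) : ℝ :=
  ∫ t in {t | t ∈ Icc a b ∧ δ ≤ |x - t|}, |K n x t|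

end SVF

end

open SVF

/-! For a metric chain y and weights c_i = (x_{i+1} - x_i) κ(x_i), split ∑ c_i y_i - p = ∑ c_i (y_i
- p) + (∑ c_i - 1) p with p ∈ F(x). Neighbouring chain points are at most the Hausdorff distance of
the values of F apart, so a chain varies no more than v_F (`dist_chain_le`). If it passes through p,
or nearly so, at a node near x, the nodes within 2δ of x contribute at most about ω(v_F, x, 4δ)
∫|κ|, the others at most 2‖F‖β, and the last term ‖F‖α. Rectangle sums of κ and |κ| miss their
integrals by at most mesh times the variation of κ, which disappears in the limit
(`norm_sum_weight_sub_le`).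

Each half of the Hausdorff bound needs suitable chains. Given p, take partitions through x and
chains through p; their bounded sums subconverge in finite dimension. Given a limit v of sums, the
chain points at the nodes just left of x accumulate, by compactness of the graph, at some p ∈ F(x).

For convergence, continuity of F passes to v_F, so ω is small uniformly on compact sets; δ is fixed
first and n chosen afterwards. -/

namespace SVF

/-! ### Variation functions and their local moduli -/

section Variation

variable {X : Type*} [PseudoMetricSpace X] {a b : ℝ} {f : ℝ → X}

theorem dist_le_varFun_sub (hf : BoundedVariationOn f (Icc a b)) {s t : ℝ} (hs : s ∈ Icc a b)
    (ht : t ∈ Icc a b) (hst : s ≤ t) :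
    dist (f s) (f t) ≤ varFun a b f t - varFun a b f s := by
  have hl := hf.locallyBoundedVariationOn
  have ha : a ∈ Icc a b := ⟨le_rfl, hs.1.trans hs.2⟩
  rw [varFun, varFun, variationOnFromTo.sub_right hl ha ht hs,
    variationOnFromTo.eq_of_le f _ hst, dist_edist]
  exact ENNReal.toReal_mono (hl s t hs ht)
    (eVariationOn.edist_le f ⟨hs, le_rfl, hst⟩ ⟨ht, hst, le_rfl⟩)

theorem varFun_monotoneOn (hab : a ≤ b) (hf : BoundedVariationOn f (Icc a b)) :
    MonotoneOn (varFun a b f) (Icc a b) :=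
  variationOnFromTo.monotoneOn hf.locallyBoundedVariationOn ⟨le_rfl, hab⟩

theorem varFun_left : varFun a b f a = 0 := variationOnFromTo.self _ _ _

theorem localModulus_varFun_nonneg (x δ : ℝ) : 0 ≤ localModulus a b (varFun a b f) x δ := by
  apply Real.sSup_nonneg
  rintro r ⟨x₁, -, x₂, -, rfl⟩
  exact dist_nonneg

theorem dist_varFun_le_localModulus (hf : BoundedVariationOn f (Icc a b)) {x δ s t : ℝ}
    (hs : s ∈ Icc a b) (ht : t ∈ Icc a b) (hsx : |s - x| ≤ δ / 2) (htx : |t - x| ≤ δ / 2) :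
    |varFun a b f s - varFun a b f t| ≤ localModulus a b (varFun a b f) x δ := by
  rw [abs_le] at hsx htx
  refine le_csSup ⟨varFun a b f b, ?_⟩
    ⟨s, ⟨⟨by linarith, by linarith⟩, hs⟩, t, ⟨⟨by linarith, by linarith⟩, ht⟩, rfl⟩
  have hab : a ≤ b := hs.1.trans hs.2
  have hm := varFun_monotoneOn hab hf
  have key : ∀ u ∈ Icc a b, 0 ≤ varFun a b f u ∧ varFun a b f u ≤ varFun a b f b := fun u hu =>
    ⟨by simpa [varFun_left] using hm ⟨le_rfl, hab⟩ hu hu.1, hm hu ⟨hab, le_rfl⟩ hu.2⟩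
  rintro r ⟨x₁, ⟨-, h₁⟩, x₂, ⟨-, h₂⟩, rfl⟩
  rw [Real.dist_eq, abs_le]
  constructor <;> linarith [(key _ h₁).1, (key _ h₁).2, (key _ h₂).1, (key _ h₂).2]

theorem localModulus_le {g : ℝ → ℝ} {x δ ε : ℝ} (hε : 0 ≤ ε)
    (h : ∀ s ∈ Icc a b, |s - x| ≤ δ / 2 → |g s - g x| ≤ ε / 2) :
    localModulus a b g x δ ≤ ε := by
  refine Real.sSup_le ?_ hε
  rintro r ⟨s, ⟨hs, hs'⟩, t, ⟨ht, ht'⟩, rfl⟩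
  have h1 := h s hs' (abs_le.2 ⟨by linarith [hs.1], by linarith [hs.2]⟩)
  have h2 := h t ht' (abs_le.2 ⟨by linarith [ht.1], by linarith [ht.2]⟩)
  rw [Real.dist_eq, abs_le]
  rw [abs_le] at h1 h2
  constructor <;> linarith

/-- The one-sided variations of a function of bounded variation vanish at a point of continuity;
their sum dominates the increment of the variation function on either side. -/
theorem continuousWithinAt_varFun (hf : BoundedVariationOn f (Icc a b)) {x : ℝ}
    (hx : x ∈ Icc a b) (hc : ContinuousWithinAt f (Icc a b) x) :
    ContinuousWithinAt (varFun a b f) (Icc a b) x := by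
  have hl := hf.locallyBoundedVariationOn
  have ha : a ∈ Icc a b := ⟨le_rfl, hx.1.trans hx.2⟩
  have h1 := (ENNReal.tendsto_toReal ENNReal.zero_ne_top).comp
    (hf.tendsto_eVariationOn_Icc_zero_left (hc.mono inter_subset_left))
  have h2 := (ENNReal.tendsto_toReal ENNReal.zero_ne_top).comp
    (hf.tendsto_eVariationOn_Icc_zero_right x (hc.mono inter_subset_left))
  have h3 := h1.add h2
  simp only [ENNReal.toReal_zero, add_zero] at h3
  rw [ContinuousWithinAt, tendsto_iff_dist_tendsto_zero]
  refine squeeze_zero' (Eventually.of_forall fun _ => dist_nonneg) ?_ h3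
  filter_upwards [self_mem_nhdsWithin] with y hy
  rw [Real.dist_eq, varFun, varFun, variationOnFromTo.sub_right hl ha hy hx]
  simp only [Function.comp_apply]
  rcases le_total x y with h | h
  · rw [variationOnFromTo.eq_of_le f _ h, abs_of_nonneg ENNReal.toReal_nonneg]
    exact le_add_of_nonneg_left ENNReal.toReal_nonneg
  · rw [variationOnFromTo.eq_of_ge f _ h, abs_neg, abs_of_nonneg ENNReal.toReal_nonneg]
    exact le_add_of_nonneg_right ENNReal.toReal_nonneg

/-- If `f` is continuous on a compact set `I ⊆ [a, b]`, relative to `[a, b]`, then the local moduli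
of its variation function tend to `0` uniformly on `I`. -/
theorem exists_localModulus_varFun_le (hab : a ≤ b) (hf : BoundedVariationOn f (Icc a b))
    {I : Set ℝ} (hI : IsCompact I) (hIab : I ⊆ Icc a b)
    (hc : ∀ x ∈ I, ContinuousWithinAt f (Icc a b) x) {ε : ℝ} (hε : 0 < ε) :
    ∃ η > 0, ∀ x ∈ I, ∀ δ < η, localModulus a b (varFun a b f) x (4 * δ) ≤ ε := by
  -- Extending constantly beyond `[a, b]` turns relative continuity into continuity in ℝ.
  -- Compactness then gives one radius for all pairs with only one point in `I`.
  set g : ℝ → ℝ := fun t => varFun a b f (projIcc a b hab t) with hg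
  have hgc : ∀ x ∈ I, ContinuousAt g x := by
    intro x hx
    have hpx : (projIcc a b hab x : ℝ) = x := by rw [projIcc_of_mem hab (hIab hx)]
    have h := continuousWithinAt_varFun hf (hIab hx) (hc x hx)
    have h2 : Tendsto (fun t => (projIcc a b hab t : ℝ)) (𝓝 x) (𝓝[Icc a b] x) := by
      refine tendsto_nhdsWithin_iff.2 ⟨?_, Eventually.of_forall fun t => (projIcc a b hab t).2⟩
      have : Continuous fun t => (projIcc a b hab t : ℝ) :=
        continuous_subtype_val.comp continuous_projIcc
      simpa [hpx] using this.tendsto x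
    have h3 := h.tendsto.comp h2
    simpa [ContinuousAt, hg, hpx, Function.comp_def] using h3
  have hu := hI.uniformContinuousAt_of_continuousAt g hgc (Metric.dist_mem_uniformity (half_pos hε))
  obtain ⟨η, hη, h⟩ := Metric.mem_uniformity_dist.1 hu
  -- The modulus at `4 * δ` involves points within `2 * δ < η` of `x`.
  refine ⟨η / 2, half_pos hη, fun x hx δ hδ => localModulus_le hε.le fun s hs hsx => ?_⟩
  have h4 : dist x s < η := by rw [dist_comm, Real.dist_eq]; linarith
  have h5 := h h4 hx
  simp only [hg, mem_ofPred_eq, projIcc_of_mem hab (hIab hx), projIcc_of_mem hab hs] at h5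
  rw [dist_comm, Real.dist_eq] at h5
  exact h5.le

end Variation

/-! ### Partitions -/

namespace Part

variable {a b : ℝ} (χ : Part a b)

theorem pts_le_pts {i j : ℕ} (hij : i ≤ j) (hj : j ≤ χ.n) : χ.pts i ≤ χ.pts j := by
  induction j, hij using Nat.le_induction with
  | base => exact le_rfl
  | succ k _ ih => exact (ih (by omega)).trans (χ.lt_succ k (by omega)).le

theorem pts_mem {i : ℕ} (hi : i ≤ χ.n) : χ.pts i ∈ Icc a b :=
  ⟨by simpa only [χ.pts_zero] using χ.pts_le_pts (Nat.zero_le i) hi,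
    by simpa only [χ.pts_last] using χ.pts_le_pts hi le_rfl⟩

theorem step_le_mesh {i : ℕ} (hi : i < χ.n) : χ.pts (i + 1) - χ.pts i ≤ χ.mesh :=
  le_ciSup (f := fun i : Fin χ.n => χ.pts (i + 1) - χ.pts i) (Set.finite_range _).bddAbove ⟨i, hi⟩

theorem step_pos {i : ℕ} (hi : i < χ.n) : 0 < χ.pts (i + 1) - χ.pts i :=
  sub_pos.2 (χ.lt_succ i hi)

theorem mesh_nonneg : 0 ≤ χ.mesh := Real.iSup_nonneg fun i => (χ.step_pos i.2).le

theorem mesh_le {ε : ℝ} (hε : 0 ≤ ε) (h : ∀ i < χ.n, χ.pts (i + 1) - χ.pts i ≤ ε) :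
    χ.mesh ≤ ε :=
  Real.iSup_le (fun i => h i i.2) hε

/-- The strict bound `j < χ.n` matters: metric chains carry points only at the nodes before the
last. This is where `a < b` enters. -/
theorem exists_pts_le_le (hab : a < b) {x : ℝ} (hx : x ∈ Icc a b) :
    ∃ j < χ.n, χ.pts j ≤ x ∧ x ≤ χ.pts (j + 1) := by
  classical
  have hn : χ.n ≠ 0 := fun h => hab.ne
    (χ.pts_zero.symm.trans (by have := χ.pts_last; rwa [h] at this))
  have hex : ∃ j, x ≤ χ.pts (j + 1) := ⟨χ.n - 1, by
    rw [Nat.sub_add_cancel (Nat.pos_of_ne_zero hn), χ.pts_last]; exact hx.2⟩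
  have hlt : Nat.find hex < χ.n := lt_of_le_of_lt (Nat.find_min' hex (by
    show x ≤ χ.pts (χ.n - 1 + 1)
    rw [Nat.sub_add_cancel (Nat.pos_of_ne_zero hn), χ.pts_last]; exact hx.2))
    (Nat.sub_lt (Nat.pos_of_ne_zero hn) one_pos)
  refine ⟨Nat.find hex, hlt, ?_, Nat.find_spec hex⟩
  rcases h : Nat.find hex with _ | k
  · rw [χ.pts_zero]; exact hx.1
  · have := Nat.find_min hex (m := k) (by omega)
    exact (not_le.1 this).le

/-- There are arbitrarily fine partitions of `[a, b]`, also if `a = b`. -/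
theorem exists_step_le (hab : a ≤ b) {ε : ℝ} (hε : 0 < ε) :
    ∃ χ : Part a b, ∀ i < χ.n, χ.pts (i + 1) - χ.pts i ≤ ε := by
  rcases hab.eq_or_lt with rfl | hlt
  · exact ⟨⟨0, fun _ => a, rfl, rfl, by simp⟩, by simp⟩
  obtain ⟨N, hN⟩ := exists_nat_gt ((b - a) / ε)
  have hN' : (b - a) / (N + 1 : ℝ) ≤ ε := by
    rw [div_lt_iff₀ hε] at hN
    rw [div_le_iff₀ (by positivity)]
    nlinarith
  have hpos : 0 < (b - a) / (N + 1 : ℝ) := div_pos (sub_pos.2 hlt) (by positivity)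
  refine ⟨⟨N + 1, fun i => a + i * ((b - a) / (N + 1)), by simp, ?_, ?_⟩, ?_⟩
  · push_cast; field_simp; ring
  · intro i _; push_cast; linarith
  · intro i _; push_cast; linarith

/-- There are arbitrarily fine partitions through a given point. -/
theorem exists_mesh_le_of_mem {x : ℝ} (hx : x ∈ Icc a b) {ε : ℝ} (hε : 0 < ε) :
    ∃ χ : Part a b, χ.mesh ≤ ε ∧ ∃ j ≤ χ.n, χ.pts j = x := by
  obtain ⟨χ₁, h₁⟩ := exists_step_le hx.1 hε
  obtain ⟨χ₂, h₂⟩ := exists_step_le hx.2 hε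
  -- Concatenate partitions of `[a, x]` and `[x, b]`; one of them has no steps if `x` is an
  -- endpoint.
  set q : ℕ → ℝ := fun i => if i ≤ χ₁.n then χ₁.pts i else χ₂.pts (i - χ₁.n) with hq
  have q1 : ∀ i, i ≤ χ₁.n → q i = χ₁.pts i := fun i hi => by simp [hq, hi]
  have q2 : ∀ i, χ₁.n ≤ i → q i = χ₂.pts (i - χ₁.n) := fun i hi => by
    rcases hi.eq_or_lt with rfl | h
    · simp [hq, χ₁.pts_last, χ₂.pts_zero]
    · simp [hq, not_le.2 h]
  have q3 : ∀ i < χ₁.n + χ₂.n, 0 < q (i + 1) - q i ∧ q (i + 1) - q i ≤ ε := by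
    intro i hi
    rcases lt_or_ge i χ₁.n with h | h
    · rw [q1 i h.le, q1 (i + 1) h]
      exact ⟨χ₁.step_pos h, h₁ i h⟩
    · rw [q2 i h, q2 (i + 1) (by omega), Nat.sub_add_comm h]
      exact ⟨χ₂.step_pos (by omega), h₂ _ (by omega)⟩
  refine ⟨⟨χ₁.n + χ₂.n, q, ?_, ?_, fun i hi => sub_pos.1 (q3 i hi).1⟩, mesh_le _ hε.le
    fun i hi => (q3 i hi).2, χ₁.n, Nat.le_add_right _ _, ?_⟩
  · rw [q1 0 (Nat.zero_le _), χ₁.pts_zero]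
  · rw [q2 _ (Nat.le_add_right _ _), Nat.add_sub_cancel_left, χ₂.pts_last]
  · show q χ₁.n = x
    rw [q1 _ le_rfl, χ₁.pts_last]

end Part

end SVF

/-! ### The rectangle rule for functions of bounded variation -/

namespace SVF

theorem _root_.BoundedVariationOn.intervalIntegrable_of_le {a b : ℝ} {g : ℝ → ℝ} (hab : a ≤ b)
    (hg : BoundedVariationOn g (Icc a b)) : IntervalIntegrable g volume a b := by
  obtain ⟨p, q, hp, hq, rfl⟩ := hg.locallyBoundedVariationOn.exists_monotoneOn_sub_monotoneOn
  rw [← uIcc_of_le hab] at hp hq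
  exact hp.intervalIntegrable.sub hq.intervalIntegrable

namespace Part

variable {a b : ℝ} (χ : Part a b)

theorem sum_step_mul_sub (w : ℝ → ℝ) :
    ∑ i ∈ Finset.range χ.n, (w (χ.pts (i + 1)) - w (χ.pts i)) = w b - w a := by
  rw [Finset.sum_range_sub (fun i => w (χ.pts i)), χ.pts_zero, χ.pts_last]

theorem intervalIntegrable_step {g : ℝ → ℝ} (hab : a ≤ b)
    (hg : IntervalIntegrable g volume a b) {i : ℕ} (hi : i < χ.n) :
    IntervalIntegrable g volume (χ.pts i) (χ.pts (i + 1)) := by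
  refine hg.mono_set ?_
  rw [uIcc_of_le hab, uIcc_of_le (χ.lt_succ i hi).le]
  exact Icc_subset_Icc (χ.pts_mem hi.le).1 (χ.pts_mem hi).2

theorem sum_integral {g : ℝ → ℝ} (hab : a ≤ b) (hg : IntervalIntegrable g volume a b) :
    ∑ i ∈ Finset.range χ.n, ∫ t in χ.pts i..χ.pts (i + 1), g t = ∫ t in a..b, g t := by
  rw [intervalIntegral.sum_integral_adjacent_intervals (a := χ.pts)
    fun i hi => χ.intervalIntegrable_step hab hg hi, χ.pts_zero, χ.pts_last]

/-- Error of the left rectangle rule on one subinterval, for an integrand whose increments are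
dominated by those of a monotone function. -/
theorem abs_step_mul_sub_integral_le {g w : ℝ → ℝ} (hab : a ≤ b)
    (hg : IntervalIntegrable g volume a b) (hw : MonotoneOn w (Icc a b))
    (hgw : ∀ s ∈ Icc a b, ∀ t ∈ Icc a b, s ≤ t → |g s - g t| ≤ w t - w s) {i : ℕ} (hi : i < χ.n) :
    |(χ.pts (i + 1) - χ.pts i) * g (χ.pts i) - ∫ t in χ.pts i..χ.pts (i + 1), g t| ≤
      χ.mesh * (w (χ.pts (i + 1)) - w (χ.pts i)) := by
  have hle := (χ.lt_succ i hi).le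
  have h0 := χ.pts_mem hi.le
  have h1 := χ.pts_mem (Nat.succ_le_of_lt hi)
  have hi1 := χ.intervalIntegrable_step hab hg hi
  have hc : (χ.pts (i + 1) - χ.pts i) * g (χ.pts i) =
      ∫ _ in χ.pts i..χ.pts (i + 1), g (χ.pts i) := by simp
  rw [hc, ← intervalIntegral.integral_sub intervalIntegrable_const hi1, ← Real.norm_eq_abs]
  have hb := intervalIntegral.norm_integral_le_of_norm_le_const (a := χ.pts i) (b := χ.pts (i + 1))
    (f := fun t => g (χ.pts i) - g t) (C := w (χ.pts (i + 1)) - w (χ.pts i)) (by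
      intro t ht
      rw [uIoc_of_le hle] at ht
      have htm : t ∈ Icc a b := ⟨h0.1.trans ht.1.le, ht.2.trans h1.2⟩
      exact (hgw _ h0 _ htm ht.1.le).trans (sub_le_sub_right (hw htm h1 ht.2) _))
  refine hb.trans ?_
  rw [abs_of_nonneg (sub_nonneg.2 hle), mul_comm]
  exact mul_le_mul_of_nonneg_right (χ.step_le_mesh hi) (sub_nonneg.2 (hw h0 h1 hle))

/-- The increments of `w` telescope. Keeping `w` separate from `g` lets the variation function of κ
serve for both κ and |κ|. -/
theorem abs_sum_sub_integral_le {g w : ℝ → ℝ} (hab : a ≤ b)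
    (hg : IntervalIntegrable g volume a b) (hw : MonotoneOn w (Icc a b))
    (hgw : ∀ s ∈ Icc a b, ∀ t ∈ Icc a b, s ≤ t → |g s - g t| ≤ w t - w s) :
    |(∑ i ∈ Finset.range χ.n, (χ.pts (i + 1) - χ.pts i) * g (χ.pts i)) - ∫ t in a..b, g t| ≤
      χ.mesh * (w b - w a) := by
  rw [← χ.sum_integral hab hg, ← Finset.sum_sub_distrib, ← χ.sum_step_mul_sub w, Finset.mul_sum]
  exact (Finset.abs_sum_le_sum_abs _ _).trans (Finset.sum_le_sum fun i hi =>
    χ.abs_step_mul_sub_integral_le hab hg hw hgw (Finset.mem_range.1 hi))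

end Part

/-! ### Riemann sums with a weight of bounded variation -/

section Weight

variable {a b : ℝ} {κ : ℝ → ℝ}

theorem abs_abs_sub_abs_le_varFun (hκ : BoundedVariationOn κ (Icc a b)) :
    ∀ s ∈ Icc a b, ∀ t ∈ Icc a b, s ≤ t →
      abs (|κ s| - |κ t|) ≤ varFun a b κ t - varFun a b κ s := fun _ hs _ ht hst =>
  (abs_abs_sub_abs_le_abs_sub _ _).trans
    ((Real.dist_eq _ _).symm.trans_le (dist_le_varFun_sub hκ hs ht hst))

theorem varFun_right_nonneg (hab : a ≤ b) : 0 ≤ varFun a b κ b :=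
  variationOnFromTo.nonneg_of_le _ _ hab

theorem abs_sum_weight_sub_integral_le (hab : a ≤ b) (hκ : BoundedVariationOn κ (Icc a b))
    (χ : Part a b) :
    |(∑ i ∈ Finset.range χ.n, (χ.pts (i + 1) - χ.pts i) * κ (χ.pts i)) - ∫ t in a..b, κ t| ≤
      χ.mesh * varFun a b κ b := by
  simpa [varFun_left] using χ.abs_sum_sub_integral_le hab (hκ.intervalIntegrable_of_le hab)
    (varFun_monotoneOn hab hκ) fun s hs t ht hst =>
      (Real.dist_eq _ _).symm.trans_le (dist_le_varFun_sub hκ hs ht hst)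

theorem sum_abs_weight_le (hab : a ≤ b) (hκ : BoundedVariationOn κ (Icc a b)) (χ : Part a b) :
    ∑ i ∈ Finset.range χ.n, (χ.pts (i + 1) - χ.pts i) * |κ (χ.pts i)| ≤
      (∫ t in a..b, |κ t|) + χ.mesh * varFun a b κ b := by
  have h := χ.abs_sum_sub_integral_le hab (hκ.intervalIntegrable_of_le hab).abs
    (varFun_monotoneOn hab hκ) (abs_abs_sub_abs_le_varFun hκ)
  rw [varFun_left, sub_zero] at h
  linarith [(abs_le.1 h).2]

/-- The part of a Riemann sum of `|κ|` belonging to the nodes far from `x`. -/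
theorem sum_far_abs_weight_le (hab : a ≤ b) (hκ : BoundedVariationOn κ (Icc a b)) (χ : Part a b)
    {x δ : ℝ} (hδ : χ.mesh ≤ δ) :
    ∑ i ∈ Finset.range χ.n, (if 2 * δ ≤ |χ.pts i - x| then
      (χ.pts (i + 1) - χ.pts i) * |κ (χ.pts i)| else 0) ≤
      (∫ t in {t | t ∈ Icc a b ∧ δ ≤ |x - t|}, |κ t|) + χ.mesh * varFun a b κ b := by
  have hint := (hκ.intervalIntegrable_of_le hab).abs
  set D : Set ℝ := {t | δ ≤ |x - t|} with hD
  have hDm : MeasurableSet D :=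
    measurableSet_le measurable_const ((measurable_const.sub measurable_id).abs)
  set h : ℝ → ℝ := D.indicator fun t => |κ t| with hh
  have hh0 : ∀ t, 0 ≤ h t := fun t => indicator_nonneg (fun _ _ => abs_nonneg _) _
  have hhint : IntervalIntegrable h volume a b := by
    rw [intervalIntegrable_iff] at hint ⊢
    exact hint.indicator hDm
  have hβ : (∫ t in {t | t ∈ Icc a b ∧ δ ≤ |x - t|}, |κ t|) = ∫ t in a..b, h t := by
    rw [intervalIntegral.integral_of_le hab, ← integral_Icc_eq_integral_Ioc, hh,
      setIntegral_indicator hDm]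
    rfl
  have hw := varFun_monotoneOn hab hκ
  have hsum := χ.sum_step_mul_sub (varFun a b κ)
  rw [varFun_left, sub_zero] at hsum
  rw [hβ, ← χ.sum_integral hab hhint, ← hsum, Finset.mul_sum, ← Finset.sum_add_distrib]
  refine Finset.sum_le_sum fun i hi => ?_
  rw [Finset.mem_range] at hi
  have hle := (χ.lt_succ i hi).le
  have hn1 : 0 ≤ ∫ t in χ.pts i..χ.pts (i + 1), h t :=
    intervalIntegral.integral_nonneg hle fun t _ => hh0 t
  have hn2 : 0 ≤ χ.mesh * (varFun a b κ (χ.pts (i + 1)) - varFun a b κ (χ.pts i)) :=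
    mul_nonneg χ.mesh_nonneg (sub_nonneg.2 (hw (χ.pts_mem hi.le) (χ.pts_mem hi) hle))
  split_ifs with hfar
  -- A node at distance at least `2 * δ`, with steps at most `δ`, keeps its whole subinterval inside
  -- `D`, where `h` equals |κ|.
  · have h1 := χ.abs_step_mul_sub_integral_le hab hint hw (abs_abs_sub_abs_le_varFun hκ) hi
    have h2 : ∫ t in χ.pts i..χ.pts (i + 1), h t = ∫ t in χ.pts i..χ.pts (i + 1), |κ t| := by
      refine intervalIntegral.integral_congr fun t ht => ?_
      rw [uIcc_of_le hle] at ht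
      refine indicator_of_mem ?_ _
      have hst := χ.step_le_mesh hi
      have h3 : |χ.pts i - x| ≤ |χ.pts i - t| + |t - x| := abs_sub_le _ _ _
      have h4 : |χ.pts i - t| ≤ δ := by
        rw [abs_sub_comm, abs_of_nonneg (sub_nonneg.2 ht.1)]
        linarith [ht.2]
      rw [abs_sub_comm t x] at h3
      show δ ≤ |x - t|
      linarith
    rw [h2]
    linarith [(abs_le.1 h1).2]
  · exact add_nonneg hn1 hn2

variable {E : Type*} [NormedAddCommGroup E] [NormedSpace ℝ E]

theorem norm_sum_weight_le (hab : a ≤ b) (hκ : BoundedVariationOn κ (Icc a b)) (χ : Part a b)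
    {y : ℕ → E} {S : ℝ} (hS : 0 ≤ S) (hy : ∀ i < χ.n, ‖y i‖ ≤ S) :
    ‖∑ i ∈ Finset.range χ.n, ((χ.pts (i + 1) - χ.pts i) * κ (χ.pts i)) • y i‖ ≤
      S * ((∫ t in a..b, |κ t|) + χ.mesh * varFun a b κ b) := by
  refine (norm_sum_le _ _).trans (le_trans ?_
    (mul_le_mul_of_nonneg_left (sum_abs_weight_le hab hκ χ) hS))
  rw [Finset.mul_sum]
  refine Finset.sum_le_sum fun i hi => ?_
  rw [Finset.mem_range] at hi
  rw [norm_smul, Real.norm_eq_abs, abs_mul, abs_of_pos (χ.step_pos hi), mul_comm]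
  exact mul_le_mul_of_nonneg_right (hy i hi)
    (mul_nonneg (χ.step_pos hi).le (abs_nonneg _))

/-- A weighted Riemann sum of points `y i` which are `ρ`-close to `p` at the nodes near `x`. -/
theorem norm_sum_weight_sub_le (hab : a ≤ b) (hκ : BoundedVariationOn κ (Icc a b)) (χ : Part a b)
    {x δ S ρ : ℝ} (hδ : χ.mesh ≤ δ) {y : ℕ → E} {p : E} (hρ : 0 ≤ ρ) (hp : ‖p‖ ≤ S)
    (hy : ∀ i < χ.n, ‖y i‖ ≤ S) (hnear : ∀ i < χ.n, |χ.pts i - x| < 2 * δ → ‖y i - p‖ ≤ ρ) :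
    ‖(∑ i ∈ Finset.range χ.n, ((χ.pts (i + 1) - χ.pts i) * κ (χ.pts i)) • y i) - p‖ ≤
      ρ * (∫ t in a..b, |κ t|) +
        S * (2 * (∫ t in {t | t ∈ Icc a b ∧ δ ≤ |x - t|}, |κ t|) + |(∫ t in a..b, κ t) - 1|) +
        χ.mesh * ((ρ + 3 * S) * varFun a b κ b) := by
  have hS : 0 ≤ S := (norm_nonneg p).trans hp
  set c : ℕ → ℝ := fun i => (χ.pts (i + 1) - χ.pts i) * κ (χ.pts i) with hc
  have hdec : (∑ i ∈ Finset.range χ.n, c i • y i) - p =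
      (∑ i ∈ Finset.range χ.n, c i • (y i - p)) + ((∑ i ∈ Finset.range χ.n, c i) - 1) • p := by
    simp only [smul_sub, Finset.sum_sub_distrib, sub_smul, Finset.sum_smul, one_smul]
    abel
  -- Far nodes cost `2 * S`; charging `ρ` to all nodes is harmless. With the error of `∑ c i`
  -- multiplied by `S`, this yields the constant `ρ + 3 * S`.
  have h1 : ‖∑ i ∈ Finset.range χ.n, c i • (y i - p)‖ ≤
      ρ * (∑ i ∈ Finset.range χ.n, (χ.pts (i + 1) - χ.pts i) * |κ (χ.pts i)|) +
      2 * S * ∑ i ∈ Finset.range χ.n, (if 2 * δ ≤ |χ.pts i - x| then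
        (χ.pts (i + 1) - χ.pts i) * |κ (χ.pts i)| else 0) := by
    refine (norm_sum_le _ _).trans ?_
    rw [Finset.mul_sum, Finset.mul_sum, ← Finset.sum_add_distrib]
    refine Finset.sum_le_sum fun i hi => ?_
    rw [Finset.mem_range] at hi
    have hpos : 0 ≤ (χ.pts (i + 1) - χ.pts i) * |κ (χ.pts i)| :=
      mul_nonneg (χ.step_pos hi).le (abs_nonneg _)
    rw [norm_smul, hc, Real.norm_eq_abs, abs_mul, abs_of_pos (χ.step_pos hi), mul_comm]
    split_ifs with hfar
    · have : ‖y i - p‖ ≤ 2 * S := (norm_sub_le _ _).trans (by linarith [hy i hi])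
      exact (mul_le_mul_of_nonneg_right this hpos).trans
        (le_add_of_nonneg_left (mul_nonneg hρ hpos))
    · rw [mul_zero, add_zero]
      exact mul_le_mul_of_nonneg_right (hnear i hi (not_le.1 hfar)) hpos
  have h2 := mul_le_mul_of_nonneg_left (sum_abs_weight_le hab hκ χ) hρ
  have h3 := mul_le_mul_of_nonneg_left (sum_far_abs_weight_le hab hκ χ (x := x) hδ)
    (mul_nonneg zero_le_two hS)
  have h4 : |(∑ i ∈ Finset.range χ.n, c i) - 1| ≤
      χ.mesh * varFun a b κ b + |(∫ t in a..b, κ t) - 1| :=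
    (abs_sub_le _ (∫ t in a..b, κ t) _).trans
      (add_le_add_left (abs_sum_weight_sub_integral_le hab hκ χ) _)
  have h5 : ‖((∑ i ∈ Finset.range χ.n, c i) - 1) • p‖ ≤
      (χ.mesh * varFun a b κ b + |(∫ t in a..b, κ t) - 1|) * S := by
    rw [norm_smul]
    exact mul_le_mul h4 hp (norm_nonneg _) ((abs_nonneg _).trans h4)
  rw [hdec]
  refine (norm_add_le _ _).trans ?_
  linarith

end Weight

end SVF

namespace SVF

/-! ### Metric chains -/

section Chain

variable {E : Type*} [MetricSpace E]

theorem infDist_le_dist_nonemptyCompacts (A B : NonemptyCompacts E) {u : E} (hu : u ∈ A) :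
    Metric.infDist u (B : Set E) ≤ dist A B := by
  rw [Metric.NonemptyCompacts.dist_eq]
  exact Metric.infDist_le_hausdorffDist_of_mem hu
    (Metric.hausdorffEDist_ne_top_of_nonempty_of_bounded A.nonempty B.nonempty
      A.isCompact.isBounded B.isCompact.isBounded)

theorem IsMetricPair.dist_le {A B : NonemptyCompacts E} {u v : E}
    (h : IsMetricPair (A : Set E) B u v) : dist u v ≤ dist A B := by
  obtain ⟨hu, hv, h | h⟩ := h
  · rw [dist_comm, h, dist_comm A B]
    exact infDist_le_dist_nonemptyCompacts B A hv
  · rw [h]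
    exact infDist_le_dist_nonemptyCompacts A B hu

theorem exists_metricPair_right (A B : NonemptyCompacts E) {u : E} (hu : u ∈ A) :
    ∃ v, IsMetricPair (A : Set E) B u v := by
  obtain ⟨v, hv, h⟩ := B.isCompact.exists_infDist_eq_dist B.nonempty u
  exact ⟨v, hu, hv, Or.inr h.symm⟩

theorem exists_metricPair_left (A B : NonemptyCompacts E) {v : E} (hv : v ∈ B) :
    ∃ u, IsMetricPair (A : Set E) B u v := by
  obtain ⟨u, hu, h⟩ := A.isCompact.exists_infDist_eq_dist A.nonempty v
  exact ⟨u, hu, hv, Or.inl h.symm⟩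

/-- Project successively onto the next set. -/
theorem exists_chain_from_zero (A : ℕ → NonemptyCompacts E) {p : E} (hp : p ∈ A 0) :
    ∃ y : ℕ → E, y 0 = p ∧ ∀ i, IsMetricPair (A i : Set E) (A (i + 1)) (y i) (y (i + 1)) := by
  choose next hnext using fun (i : ℕ) (u : A i) => exists_metricPair_right (A i) (A (i + 1)) u.2
  let z : ∀ i, A i := fun i => Nat.rec ⟨p, hp⟩ (fun k u => ⟨next k u, (hnext k u).2.1⟩) i
  refine ⟨fun i => (z i).1, rfl, fun i => ?_⟩
  exact hnext i (z i)

/-- Every point of a set in a sequence lies on a metric chain of the sequence. -/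
theorem exists_chain_through (j : ℕ) : ∀ (A : ℕ → NonemptyCompacts E) {p : E}, p ∈ A j →
    ∃ y : ℕ → E, y j = p ∧ ∀ i, IsMetricPair (A i : Set E) (A (i + 1)) (y i) (y (i + 1)) := by
  induction j with
  | zero => exact fun A p hp => exists_chain_from_zero A hp
  | succ j ih =>
    intro A p hp
    -- Build the chain for the shifted sequence, then prepend a projection of its first point onto
    -- `A 0`.
    obtain ⟨y, hy, h⟩ := ih (fun i => A (i + 1)) hp
    obtain ⟨u, hu⟩ := exists_metricPair_left (A 0) (A 1) (h 0).1
    refine ⟨fun i => Nat.casesOn i u y, hy, fun i => ?_⟩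
    cases i with
    | zero => exact hu
    | succ i => exact h i

theorem isMetricChain_of_forall {A : ℕ → NonemptyCompacts E} {y : ℕ → E}
    (h : ∀ i, IsMetricPair (A i : Set E) (A (i + 1)) (y i) (y (i + 1))) (m : ℕ) :
    IsMetricChain m (fun i => (A i : Set E)) y :=
  ⟨fun i _ => (h i).1, fun i _ => h i⟩

/-- Along a chain of metric pairs the points vary at most as much as the multifunction. -/
theorem dist_chain_le {a b : ℝ} {F : ℝ → NonemptyCompacts E} (hF : BoundedVariationOn F (Icc a b))
    (χ : Part a b) {y : ℕ → E} {N : ℕ} (hN : N ≤ χ.n)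
    (h : ∀ i < N, IsMetricPair (F (χ.pts i) : Set E) (F (χ.pts (i + 1))) (y i) (y (i + 1)))
    {i j : ℕ} (hi : i ≤ N) (hj : j ≤ N) :
    dist (y i) (y j) ≤ |varFun a b F (χ.pts i) - varFun a b F (χ.pts j)| := by
  wlog hij : i ≤ j generalizing i j
  · rw [dist_comm, abs_sub_comm]
    exact this hj hi (le_of_not_ge hij)
  rw [abs_sub_comm]
  refine le_trans ?_ (le_abs_self _)
  induction j, hij using Nat.le_induction with
  | base => simp
  | succ k hk ih =>
    have h1 := ih (by omega)
    have h2 := (h k (by omega)).dist_le.trans (dist_le_varFun_sub hF (χ.pts_mem (by omega))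
      (χ.pts_mem (by omega)) (χ.lt_succ k (by omega)).le)
    linarith [dist_triangle (y i) (y k) (y (k + 1))]

end Chain

/-! ### Distance between the weighted metric integral and a value of F -/

section Integral

variable {E : Type*} [NormedAddCommGroup E] {a b : ℝ} {F : ℝ → NonemptyCompacts E} {κ : ℝ → ℝ}

theorem norm_le_supNorm (hF : IsCompact (graphOn a b F)) {x : ℝ} (hx : x ∈ Icc a b) {y : E}
    (hy : y ∈ F x) : ‖y‖ ≤ supNorm a b F := by
  have hdist : ∀ A : NonemptyCompacts E, ∀ z ∈ A, ‖z‖ ≤ Metric.hausdorffDist (A : Set E) {0} := by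
    intro A z hz
    have := Metric.infDist_le_hausdorffDist_of_mem (x := z) (s := (A : Set E)) (t := {0}) hz
      (Metric.hausdorffEDist_ne_top_of_nonempty_of_bounded A.nonempty (singleton_nonempty _)
        A.isCompact.isBounded Bornology.isBounded_singleton)
    simpa using this
  refine (hdist _ _ hy).trans
    (le_ciSup (f := fun x : Icc a b => Metric.hausdorffDist (F x : Set E) {0}) ?_ ⟨x, hx⟩)
  -- Boundedness of the graph makes the supremum genuine; an unbounded real `⨆` would default to 0.
  obtain ⟨C, hC⟩ := hF.isBounded.exists_norm_le
  have hC' : ∀ t ∈ Icc a b, ∀ z ∈ F t, ‖z‖ ≤ C := fun t ht z hz =>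
    (norm_snd_le (t, z)).trans (hC (t, z) ⟨ht, hz⟩)
  have hC0 : 0 ≤ C := (norm_nonneg y).trans (hC' x hx y hy)
  refine ⟨C, ?_⟩
  rintro _ ⟨t, rfl⟩
  refine Metric.hausdorffDist_le_of_mem_dist hC0
    (fun z hz => ⟨0, rfl, by simpa using hC' t t.2 z hz⟩) ?_
  rintro _ rfl
  obtain ⟨z, hz⟩ := (F t).nonempty
  exact ⟨z, hz, by simpa using hC' t t.2 z hz⟩

/-- The bound of the distance between the metric integral of `F` with weight `κ` and `F x`. -/
noncomputable def integralErrorBound (a b : ℝ) (κ : ℝ → ℝ) (F : ℝ → NonemptyCompacts E)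
    (x δ : ℝ) : ℝ :=
  localModulus a b (varFun a b F) x (4 * δ) * (∫ t in a..b, |κ t|) +
    supNorm a b F * (2 * (∫ t in {t | t ∈ Icc a b ∧ δ ≤ |x - t|}, |κ t|) +
      |(∫ t in a..b, κ t) - 1|)

theorem integralErrorBound_nonneg (hab : a ≤ b) (x δ : ℝ) :
    0 ≤ integralErrorBound a b κ F x δ := by
  have h1 := localModulus_varFun_nonneg (a := a) (b := b) (f := F) x (4 * δ)
  have h2 : 0 ≤ ∫ t in a..b, |κ t| :=
    intervalIntegral.integral_nonneg hab fun _ _ => abs_nonneg _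
  have h3 : 0 ≤ supNorm a b F := Real.iSup_nonneg fun _ => Metric.hausdorffDist_nonneg
  have h4 : 0 ≤ ∫ t in {t | t ∈ Icc a b ∧ δ ≤ |x - t|}, |κ t| :=
    integral_nonneg fun _ => abs_nonneg _
  have h5 := abs_nonneg ((∫ t in a..b, κ t) - 1)
  unfold integralErrorBound
  positivity

variable [NormedSpace ℝ E]

/-- A subsequence of partitions still has mesh tending to 0, so the subsequence in the Kuratowski
limit adds nothing. -/
theorem mem_weightedMetricIntegral_iff {v : E} :
    v ∈ weightedMetricIntegral a b κ F ↔
      ∀ ε > 0, ∃ χ : Part a b, χ.mesh < ε ∧ ∃ w ∈ metricRiemannSum κ F χ, dist w v < ε := by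
  constructor
  · rintro ⟨χ, hχ, φ, hφ, w, hw, hwv⟩ ε hε
    have h1 := (hχ.comp hφ.tendsto_atTop).eventually (gt_mem_nhds hε)
    have h2 := hwv.eventually (Metric.ball_mem_nhds v hε)
    obtain ⟨k, hk1, hk2⟩ := (h1.and h2).exists
    exact ⟨χ (φ k), hk1, w k, hw k, hk2⟩
  · intro h
    choose χ hχ w hw hwv using fun k : ℕ => h (1 / (k + 1)) Nat.one_div_pos_of_nat
    have h0 := tendsto_one_div_add_atTop_nhds_zero_nat (𝕜 := ℝ)
    refine ⟨χ, squeeze_zero (fun k => (χ k).mesh_nonneg) (fun k => (hχ k).le) h0, id,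
      strictMono_id, w, hw, ?_⟩
    rw [tendsto_iff_dist_tendsto_zero]
    exact squeeze_zero (fun _ => dist_nonneg) (fun k => (hwv k).le) h0

theorem isClosed_weightedMetricIntegral : IsClosed (weightedMetricIntegral a b κ F) := by
  refine isClosed_of_closure_subset fun v hv => mem_weightedMetricIntegral_iff.2 fun ε hε => ?_
  obtain ⟨u, hu, huv⟩ := Metric.mem_closure_iff.1 hv (ε / 2) (half_pos hε)
  obtain ⟨χ, hχ, w, hw, hwu⟩ := mem_weightedMetricIntegral_iff.1 hu (ε / 2) (half_pos hε)
  refine ⟨χ, by linarith, w, hw, ?_⟩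
  rw [dist_comm] at huv
  linarith [dist_triangle w u v]

theorem norm_le_of_mem_metricRiemannSum (hab : a ≤ b) (hF : IsCompact (graphOn a b F))
    (hκ : BoundedVariationOn κ (Icc a b)) {χ : Part a b} {w : E}
    (hw : w ∈ metricRiemannSum κ F χ) :
    ‖w‖ ≤ supNorm a b F * ((∫ t in a..b, |κ t|) + χ.mesh * varFun a b κ b) := by
  obtain ⟨y, hy, rfl⟩ := hw
  refine norm_sum_weight_le hab hκ χ ?_ fun i hi =>
    norm_le_supNorm hF (χ.pts_mem hi.le) (hy.1 i hi)
  exact Real.iSup_nonneg fun _ => Metric.hausdorffDist_nonneg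

theorem norm_le_of_mem_metricRiemannSum_of_mesh_le_one (hab : a ≤ b)
    (hF : IsCompact (graphOn a b F)) (hκ : BoundedVariationOn κ (Icc a b)) {χ : Part a b}
    (hχ : χ.mesh ≤ 1) {w : E} (hw : w ∈ metricRiemannSum κ F χ) :
    ‖w‖ ≤ supNorm a b F * ((∫ t in a..b, |κ t|) + varFun a b κ b) := by
  refine (norm_le_of_mem_metricRiemannSum hab hF hκ hw).trans ?_
  refine mul_le_mul_of_nonneg_left ?_ (Real.iSup_nonneg fun _ => Metric.hausdorffDist_nonneg)
  exact add_le_add_right (mul_le_of_le_one_left (varFun_right_nonneg hab) hχ) _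

theorem isCompact_weightedMetricIntegral [FiniteDimensional ℝ E] (hab : a ≤ b)
    (hF : IsCompact (graphOn a b F))
    (hκ : BoundedVariationOn κ (Icc a b)) : IsCompact (weightedMetricIntegral a b κ F) := by
  have := FiniteDimensional.proper_real E
  refine Metric.isCompact_of_isClosed_isBounded isClosed_weightedMetricIntegral
    (isBounded_iff_forall_norm_le.2
      ⟨supNorm a b F * ((∫ t in a..b, |κ t|) + varFun a b κ b) + 1, fun v hv => ?_⟩)
  obtain ⟨χ, hχ, w, hw, hwv⟩ := mem_weightedMetricIntegral_iff.1 hv 1 one_pos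
  have h1 := norm_le_of_mem_metricRiemannSum_of_mesh_le_one hab hF hκ hχ.le hw
  rw [dist_comm] at hwv
  have := norm_le_norm_add_norm_sub' v w
  rw [dist_eq_norm] at hwv
  linarith

/-- Partitions having `x` as a node carry chains through `p`; a subsequential limit of their sums is
the required point. -/
theorem exists_mem_weightedMetricIntegral_dist_le [FiniteDimensional ℝ E] (hab : a ≤ b)
    (hF : IsBVCompactGraph a b F)
    (hκ : BoundedVariationOn κ (Icc a b)) {x δ : ℝ} (hx : x ∈ Icc a b) (hδ : 0 < δ) {p : E}
    (hp : p ∈ F x) :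
    ∃ v ∈ weightedMetricIntegral a b κ F, dist p v ≤ integralErrorBound a b κ F x δ := by
  have := FiniteDimensional.proper_real E
  set ω := localModulus a b (varFun a b F) x (4 * δ) with hω
  have hω0 : 0 ≤ ω := localModulus_varFun_nonneg _ _
  set S := supNorm a b F with hS
  set V := varFun a b κ b with hV
  have key : ∀ ε > 0, ε ≤ δ → ∃ χ : Part a b, χ.mesh ≤ ε ∧ ∃ w ∈ metricRiemannSum κ F χ,
      dist w p ≤ integralErrorBound a b κ F x δ + χ.mesh * ((ω + 3 * S) * V) := by
    intro ε hε hεδ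
    obtain ⟨χ, hχ, j, hj, hjx⟩ := Part.exists_mesh_le_of_mem hx hε
    obtain ⟨y, hyp, hy⟩ := exists_chain_through j (fun i => F (χ.pts i)) (p := p)
      (by simpa only [hjx] using hp)
    refine ⟨χ, hχ, _, ⟨y, isMetricChain_of_forall hy _, rfl⟩, ?_⟩
    rw [dist_eq_norm]
    refine norm_sum_weight_sub_le hab hκ χ (hχ.trans hεδ) hω0 (norm_le_supNorm hF.2 hx hp)
      (fun i hi => norm_le_supNorm hF.2 (χ.pts_mem hi.le) (hy i).1) fun i hi hix => ?_
    rw [← dist_eq_norm, ← hyp]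
    -- If `x = b`, then `j = χ.n` lies beyond the points entering the sum; the chain `y` was built
    -- for all indices, so the last link is available.
    refine (dist_chain_le hF.1 χ le_rfl (fun i _ => hy i) hi.le hj).trans ?_
    refine dist_varFun_le_localModulus hF.1 (χ.pts_mem hi.le) (χ.pts_mem hj) (by linarith) ?_
    rw [hjx, sub_self, abs_zero]
    linarith
  have h0 := tendsto_one_div_add_atTop_nhds_zero_nat (𝕜 := ℝ)
  -- `δ` is for the error estimate, 1 for a uniform bound of the sums, `1 / (k + 1)` for the limit.
  have hmin : ∀ k : ℕ, 0 < min (min δ 1) (1 / ((k : ℝ) + 1)) := fun k =>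
    lt_min (lt_min hδ one_pos) Nat.one_div_pos_of_nat
  choose χ hχ w hw hwp using fun k : ℕ => key _ (hmin k) ((min_le_left _ _).trans (min_le_left _ _))
  have hmesh : Tendsto (fun k => (χ k).mesh) atTop (𝓝 0) :=
    squeeze_zero (fun k => (χ k).mesh_nonneg) (fun k => (hχ k).trans (min_le_right _ _)) h0
  obtain ⟨v, -, φ, hφ, hv⟩ := tendsto_subseq_of_bounded
    (Metric.isBounded_closedBall (x := (0 : E)) (r := S * ((∫ t in a..b, |κ t|) + V)))
    (x := w) fun k => mem_closedBall_zero_iff.2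
      (norm_le_of_mem_metricRiemannSum_of_mesh_le_one hab hF.2 hκ
        ((hχ k).trans ((min_le_left _ _).trans (min_le_right _ _))) (hw k))
  refine ⟨v, ⟨χ, hmesh, φ, hφ, w ∘ φ, fun k => hw _, hv⟩, ?_⟩
  rw [dist_comm]
  have hlim := ((hmesh.comp hφ.tendsto_atTop).mul_const ((ω + 3 * S) * V)).const_add
    (integralErrorBound a b κ F x δ)
  rw [zero_mul, add_zero] at hlim
  exact le_of_tendsto_of_tendsto' (hv.dist tendsto_const_nhds) hlim fun k => hwp (φ k)

/-- Here the partitions are given and may miss `x`. Closeness to `p` is only asymptotic: `ρ` is ω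
plus an error tending to 0. Compactness of the graph puts `p` in `F x` even where `F` is
discontinuous. -/
theorem exists_mem_dist_le_of_mem_weightedMetricIntegral (hab : a < b)
    (hF : IsBVCompactGraph a b F) (hκ : BoundedVariationOn κ (Icc a b)) {x δ : ℝ}
    (hx : x ∈ Icc a b) (hδ : 0 < δ) {v : E} (hv : v ∈ weightedMetricIntegral a b κ F) :
    ∃ p ∈ F x, dist v p ≤ integralErrorBound a b κ F x δ := by
  set ω := localModulus a b (varFun a b F) x (4 * δ) with hω
  have hω0 : 0 ≤ ω := localModulus_varFun_nonneg _ _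
  set S := supNorm a b F with hS
  set V := varFun a b κ b with hV
  have h0 := tendsto_one_div_add_atTop_nhds_zero_nat (𝕜 := ℝ)
  have hmin : ∀ k : ℕ, 0 < min δ (1 / ((k : ℝ) + 1)) := fun k =>
    lt_min hδ Nat.one_div_pos_of_nat
  choose χ hχ w hw hwv using fun k : ℕ => mem_weightedMetricIntegral_iff.1 hv _ (hmin k)
  have hmesh : Tendsto (fun k => (χ k).mesh) atTop (𝓝 0) :=
    squeeze_zero (fun k => (χ k).mesh_nonneg) (fun k => (hχ k).le.trans (min_le_right _ _)) h0
  have hwlim : Tendsto w atTop (𝓝 v) := by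
    rw [tendsto_iff_dist_tendsto_zero]
    exact squeeze_zero (fun _ => dist_nonneg) (fun k => (hwv k).le.trans (min_le_right _ _)) h0
  choose y hy hwy using hw
  choose j hjn hjx hxj using fun k => (χ k).exists_pts_le_le hab hx
  have hnode : ∀ k, |(χ k).pts (j k) - x| ≤ (χ k).mesh := fun k => by
    rw [abs_sub_comm, abs_of_nonneg (sub_nonneg.2 (hjx k))]
    linarith [(χ k).step_le_mesh (hjn k), hxj k]
  obtain ⟨⟨x', p⟩, ⟨-, hp⟩, φ, hφ, hlim⟩ := hF.2.tendsto_subseq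
    (x := fun k => ((χ k).pts (j k), y k (j k)))
    fun k => ⟨(χ k).pts_mem (hjn k).le, (hy k).1 _ (hjn k)⟩
  have hmφ := hmesh.comp hφ.tendsto_atTop
  have hlim1 : Tendsto (fun k => (χ (φ k)).pts (j (φ k))) atTop (𝓝 x') :=
    (continuous_fst.tendsto _).comp hlim
  have hlim2 : Tendsto (fun k => y (φ k) (j (φ k))) atTop (𝓝 p) :=
    (continuous_snd.tendsto _).comp hlim
  have hx' : x' = x := by
    refine tendsto_nhds_unique hlim1 ?_
    rw [tendsto_iff_dist_tendsto_zero]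
    exact squeeze_zero (fun _ => dist_nonneg) (fun k => hnode (φ k)) hmφ
  subst hx'
  refine ⟨p, hp, ?_⟩
  have hρ : Tendsto (fun k => ω + dist (y (φ k) (j (φ k))) p) atTop (𝓝 ω) := by
    simpa using (hlim2.dist (tendsto_const_nhds (x := p))).const_add ω
  have hest : ∀ k, dist (w (φ k)) p ≤
      (ω + dist (y (φ k) (j (φ k))) p) * (∫ t in a..b, |κ t|) +
        S * (2 * (∫ t in {t | t ∈ Icc a b ∧ δ ≤ |x' - t|}, |κ t|) + |(∫ t in a..b, κ t) - 1|) +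
        (χ (φ k)).mesh * ((ω + dist (y (φ k) (j (φ k))) p + 3 * S) * V) := by
    intro k
    have hmδ : (χ (φ k)).mesh ≤ δ := (hχ (φ k)).le.trans (min_le_left _ _)
    rw [hwy, dist_eq_norm]
    refine norm_sum_weight_sub_le hab.le hκ _ hmδ (add_nonneg hω0 dist_nonneg)
      (norm_le_supNorm hF.2 hx hp)
      (fun i hi => norm_le_supNorm hF.2 ((χ (φ k)).pts_mem hi.le) ((hy _).1 i hi))
      fun i hi hix => ?_
    rw [← dist_eq_norm]
    refine (dist_triangle _ (y (φ k) (j (φ k))) _).trans (add_le_add_left ?_ _)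
    -- A metric chain of `n` sets has only `n - 1` links.
    refine (dist_chain_le hF.1 (χ (φ k)) (N := (χ (φ k)).n - 1) (Nat.sub_le _ _)
      (fun i hi => (hy (φ k)).2 i (by omega)) (by omega) (by have := hjn (φ k); omega)).trans ?_
    refine dist_varFun_le_localModulus hF.1 ((χ (φ k)).pts_mem hi.le)
      ((χ (φ k)).pts_mem (hjn (φ k)).le) (by linarith) ?_
    linarith [hnode (φ k)]
  have hfin := ((hρ.mul_const (∫ t in a..b, |κ t|)).add_const
    (S * (2 * (∫ t in {t | t ∈ Icc a b ∧ δ ≤ |x' - t|}, |κ t|) + |(∫ t in a..b, κ t) - 1|))).add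
      (hmφ.mul ((hρ.add_const (3 * S)).mul_const V))
  rw [zero_mul, add_zero] at hfin
  exact le_of_tendsto_of_tendsto' ((hwlim.comp hφ.tendsto_atTop).dist tendsto_const_nhds) hfin hest

theorem nonempty_weightedMetricIntegral [FiniteDimensional ℝ E] (hab : a ≤ b)
    (hF : IsBVCompactGraph a b F)
    (hκ : BoundedVariationOn κ (Icc a b)) : (weightedMetricIntegral a b κ F).Nonempty := by
  obtain ⟨p, hp⟩ := (F a).nonempty
  obtain ⟨v, hv, -⟩ := exists_mem_weightedMetricIntegral_dist_le hab hF hκ ⟨le_rfl, hab⟩ one_pos hp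
  exact ⟨v, hv⟩

theorem hausdorffDist_weightedMetricIntegral_le [FiniteDimensional ℝ E] (hab : a < b)
    (hF : IsBVCompactGraph a b F)
    (hκ : BoundedVariationOn κ (Icc a b)) {x δ : ℝ} (hx : x ∈ Icc a b) (hδ : 0 < δ) :
    Metric.hausdorffDist (weightedMetricIntegral a b κ F) (F x : Set E) ≤
      integralErrorBound a b κ F x δ :=
  Metric.hausdorffDist_le_of_mem_dist (integralErrorBound_nonneg hab.le x δ)
    (fun _ hv => exists_mem_dist_le_of_mem_weightedMetricIntegral hab hF hκ hx hδ hv)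
    fun _ hp => exists_mem_weightedMetricIntegral_dist_le hab.le hF hκ hx hδ hp

end Integral

end SVF

namespace SVF

/-! ### Convergence of the operators -/

section Operators

variable {E : Type*} [NormedAddCommGroup E] [NormedSpace ℝ E] [FiniteDimensional ℝ E]
  {a b : ℝ} {F : ℝ → NonemptyCompacts E} {K : ℕ → ℝ → ℝ → ℝ}

theorem hausdorffDist_metricOp_le (hab : a < b) (hF : IsBVCompactGraph a b F) {n : ℕ} {x δ : ℝ}
    (hK : BoundedVariationOn (K n x) (Icc a b)) (hx : x ∈ Icc a b) (hδ : 0 < δ) :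
    Metric.hausdorffDist (metricOp a b K F n x) (F x : Set E) ≤
      localModulus a b (varFun a b F) x (4 * δ) * (∫ t in a..b, |K n x t|) +
        supNorm a b F * (2 * kerBeta a b K n x δ + kerAlpha a b K n x) :=
  hausdorffDist_weightedMetricIntegral_le hab hF hK hx hδ

/-- Allowing any compact `I` covers both a single point and a closed interval. -/
theorem tendstoUniformlyOn_hausdorffDist_metricOp (hab : a < b) (hF : IsBVCompactGraph a b F)
    (hK : ∀ n, ∀ x ∈ Icc a b, BoundedVariationOn (K n x) (Icc a b)) {I : Set ℝ}
    (hI : IsCompact I) (hIab : I ⊆ Icc a b) (hc : ∀ x ∈ I, ContinuousWithinAt F (Icc a b) x)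
    (hα : TendstoUniformlyOn (fun n x => kerAlpha a b K n x) (fun _ => 0) atTop I)
    (hβ : ∀ᶠ δ in 𝓝[>] (0 : ℝ),
      TendstoUniformlyOn (fun n x => kerBeta a b K n x δ) (fun _ => 0) atTop I)
    {C : ℝ} (hC : ∀ x ∈ I, ∀ n, ∫ t in a..b, |K n x t| ≤ C) :
    TendstoUniformlyOn (fun n x => Metric.hausdorffDist (metricOp a b K F n x) (F x : Set E))
      (fun _ => 0) atTop I := by
  rw [Metric.tendstoUniformlyOn_iff] at hα ⊢
  intro ε hε
  set S := supNorm a b F with hS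
  have hS0 : 0 ≤ S := Real.iSup_nonneg fun _ => Metric.hausdorffDist_nonneg
  -- These denominators keep each of the two error terms below `ε / 2`; adding 1 avoids division by
  -- zero.
  have hC1 : 0 < 2 * (|C| + 1) := by positivity
  have hS1 : 0 < 8 * (S + 1) := by positivity
  obtain ⟨η, hη, hω⟩ := exists_localModulus_varFun_le hab.le hF.1 hI hIab hc (div_pos hε hC1)
  obtain ⟨δ, hβδ, hδ⟩ := (hβ.and (Ioo_mem_nhdsGT hη)).exists
  rw [Metric.tendstoUniformlyOn_iff] at hβδ
  filter_upwards [hα _ (div_pos hε hS1), hβδ _ (div_pos hε hS1)] with n hαn hβn x hx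
  have h1 := hαn x hx
  have h2 := hβn x hx
  rw [dist_zero_left, Real.norm_eq_abs] at h1 h2 ⊢
  rw [abs_of_nonneg Metric.hausdorffDist_nonneg]
  have h3 := hω x hx δ hδ.2
  have h4 : localModulus a b (varFun a b F) x (4 * δ) * (∫ t in a..b, |K n x t|) ≤
      ε / (2 * (|C| + 1)) * |C| :=
    mul_le_mul h3 ((hC x hx n).trans (le_abs_self C))
      (intervalIntegral.integral_nonneg hab.le fun _ _ => abs_nonneg _) (div_pos hε hC1).le
  have h5 : ε / (2 * (|C| + 1)) * |C| < ε / 2 := by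
    rw [div_mul_eq_mul_div, div_lt_div_iff₀ hC1 two_pos]
    nlinarith
  have h6 : S * (2 * kerBeta a b K n x δ + kerAlpha a b K n x) ≤ S * (3 * (ε / (8 * (S + 1)))) :=
    mul_le_mul_of_nonneg_left (by linarith [(abs_lt.1 h1).2, (abs_lt.1 h2).2]) hS0
  have h7 : S * (3 * (ε / (8 * (S + 1)))) < ε / 2 := by
    rw [show S * (3 * (ε / (8 * (S + 1)))) = (3 * S * ε) / (8 * (S + 1)) by ring,
      div_lt_div_iff₀ hS1 two_pos]
    nlinarith [mul_nonneg hS0 hε.le]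
  have h8 := hausdorffDist_metricOp_le hab hF (hK n x (hIab hx)) (hIab hx) hδ.1
  linarith

end Operators

end SVF

theorem mainTheorem1 {E : Type*} [NormedAddCommGroup E] [NormedSpace ℝ E] [FiniteDimensional ℝ E]
    {a b : ℝ} (hab : a < b) (F : ℝ → NonemptyCompacts E) (hF : IsBVCompactGraph a b F)
    (K : ℕ → ℝ → ℝ → ℝ) (hK : ∀ n, ∀ x ∈ Icc a b, BoundedVariationOn (K n x) (Icc a b))
    (M : ℝ → ℝ≥0∞)
    (hM : ∀ x ∈ Icc a b, ∀ n, ENNReal.ofReal (∫ t in a..b, |K n x t|) ≤ M x) :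
    -- the values of the operators are nonempty compact sets
    (∀ n, ∀ x ∈ Icc a b, (metricOp a b K F n x).Nonempty ∧ IsCompact (metricOp a b K F n x)) ∧
    -- (i)
    (∀ x ∈ Icc a b, ∀ δ > 0, ∀ n,
      ENNReal.ofReal (Metric.hausdorffDist (metricOp a b K F n x) (F x : Set E)) ≤
        ENNReal.ofReal (localModulus a b (varFun a b F) x (4 * δ)) * M x +
          ENNReal.ofReal (supNorm a b F * (2 * kerBeta a b K n x δ + kerAlpha a b K n x))) ∧
    -- (ii)
    (∀ x ∈ Icc a b,
      Tendsto (fun n => kerAlpha a b K n x) atTop (𝓝 0) →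
      (∀ᶠ δ in 𝓝[>] (0 : ℝ), Tendsto (fun n => kerBeta a b K n x δ) atTop (𝓝 0)) →
      M x < ∞ →
      ContinuousWithinAt F (Icc a b) x →
      Tendsto (fun n => Metric.hausdorffDist (metricOp a b K F n x) (F x : Set E))
        atTop (𝓝 0)) ∧
    -- (iii)
    (∀ c d : ℝ, Icc c d ⊆ Icc a b →
      (∀ x ∈ Icc c d, ContinuousWithinAt F (Icc a b) x) →
      TendstoUniformlyOn (fun n x => kerAlpha a b K n x) (fun _ => 0) atTop (Icc c d) →
      (∀ᶠ δ in 𝓝[>] (0 : ℝ),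
        TendstoUniformlyOn (fun n x => kerBeta a b K n x δ) (fun _ => 0) atTop (Icc c d)) →
      (∃ C : ℝ, ∀ x ∈ Icc c d, M x ≤ ENNReal.ofReal C) →
      TendstoUniformlyOn
        (fun n x => Metric.hausdorffDist (metricOp a b K F n x) (F x : Set E))
        (fun _ => 0) atTop (Icc c d)) := by
  -- `ENNReal.ofReal` truncates a negative `C` to 0, hence `max C 0`.
  have hint : ∀ x ∈ Icc a b, ∀ C : ℝ, M x ≤ ENNReal.ofReal C → ∀ n,
      ∫ t in a..b, |K n x t| ≤ max C 0 := fun x hx C hC n =>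
    (ENNReal.ofReal_le_ofReal_iff (le_max_right _ _)).1
      ((hM x hx n).trans (hC.trans (ENNReal.ofReal_le_ofReal (le_max_left _ _))))
  refine ⟨fun n x hx => ⟨nonempty_weightedMetricIntegral hab.le hF (hK n x hx),
    isCompact_weightedMetricIntegral hab.le hF.2 (hK n x hx)⟩, ?_, ?_, ?_⟩
  · intro x hx δ hδ n
    refine (ENNReal.ofReal_le_ofReal
      (hausdorffDist_metricOp_le hab hF (hK n x hx) hx hδ)).trans ?_
    refine ENNReal.ofReal_add_le.trans (add_le_add_left ?_ _)
    -- Factoring in `ℝ≥0∞` before inserting `M x` also handles `M x = ∞`, with `0 * ∞ = 0`.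
    rw [ENNReal.ofReal_mul (localModulus_varFun_nonneg _ _)]
    exact mul_le_mul_right (hM x hx n) _
  · intro x hx hα hβ hMx hc
    have h := tendstoUniformlyOn_hausdorffDist_metricOp hab hF hK (isCompact_singleton (x := x))
      (singleton_subset_iff.2 hx) (by rintro _ rfl; exact hc)
      (tendstoUniformlyOn_singleton_iff_tendsto.2 hα)
      (hβ.mono fun δ h => tendstoUniformlyOn_singleton_iff_tendsto.2 h)
      (C := max (M x).toReal 0) (by
        rintro _ rfl n
        exact hint _ hx _ (ENNReal.ofReal_toReal hMx.ne).ge n)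
    exact tendstoUniformlyOn_singleton_iff_tendsto.1 h
  · rintro c d hcd hc hα hβ ⟨C, hC⟩
    exact tendstoUniformlyOn_hausdorffDist_metricOp hab hF hK isCompact_Icc hcd hc hα hβ
      (C := max C 0) fun x hx n => hint x (hcd hx) C (hC x hx) n
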